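/- Let $N\ge 1$ and $[N]=\{1,\dots,N\}$, and let $\mathcal G_N=\{v:2^{[N]}\to\mathbb R \mid v(\emptyset)=0\}$ be the set of cooperative games on $[N]$. The hypercube graph has vertex set $2^{[N]}$ and oriented edges $(S,S\cup\{i\})$, $i\in[N]$, $S\subset[N]\setminus\{i\}$. A function $f$ on the edges is extended to reversed edges by $f(T,S)=-f(S,T)$. For $u:2^{[N]}\to\mathbb R$ put $\mathrm d u(S,T)=u(T)-u(S)$ on edges, and let $\mathrm d_i u(S,S\cup\{j\})$ be $\mathrm d u(S,S\cup\{i\})$ if $j=i$ and $0$ if $j\ne i$; let $\mathrm d^*f(S)=\sum_{T\sim S}f(T,S)$ be the adjoint of $\mathrm d$, the sum being over the neighbours $T$ of $S$. For every $v\in\mathcal G_N$ and $i\in[N]$ the equation $\mathrm d^*\mathrm d\,v_i=\mathrm d^*\mathrm d_i v$ has a unique solution $v_i\in\mathcal G_N$ (the component game of player $i$). The allocation $v\mapsto (v_i)_{i\in[N]}$ is the only family of maps $\Phi_i:\mathcal G_N\to\mathcal G_N$ ($N\in\mathbb N$, $i\in[N]$) such that, for all $N$, all $v,v'\in\mathcal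 G_N$, all $i,j\in[N]$ and all $\alpha,\alpha'\in\mathbb R$: - A1 (efficiency): $v=\sum_{i\in[N]}\Phi_i[v]$. - A2 (symmetry): $\Phi_i[v^{ij}](S^{ij})=\Phi_j[v](S)$ for all $S\subset[N]$, where $S^{ij}$ is the image of $S$ under the transposition of $i$ and $j$, and $v^{ij}(S)=v(S^{ij})$. - A3 (null player): if $\mathrm d_i v=0$, then $\Phi_i[v]\equiv 0$ and $\Phi_k[v](S\cup\{i\})=\Phi_k[v](S)=\Phi_k[v_{-i}](S)$ for all $k\in[N]\setminus\{i\}$ and $S\subset[N]\setminus\{i\}$, where $v_{-i}$ is the restriction of $v$ to the subsets of $[N]\setminus\{i\}$, regarded as a game on $[N-1]$ by relabelling the players of $[N]\setminus\{i\}$ in increasing order. - A4 (linearity): $\Phi_i[\alpha v+\alpha'v']=\alpha\Phi_i[v]+\alpha'\Phi_i[v']$. - A5 (reflection): $\Phi_i[v](S\cup\{i\})-\Phi_i[v](T\cup\{i\})=-\bigl(\Phi_i[v](S)-\Phi_i[v](T)\bigr)$ for all $S,T\subset[N]\setminus\{i\}$. Let $(X_n)_{n\ge0}$ be a Markov chain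 on $2^{[N]}$, defined on any probability space, with $X_0=\emptyset$ almost surely and with transition probability $1/N$ between neighbours in the hypercube graph and $0$ otherwise. For $S\subset[N]$ let $\tau_S$ be the first time $n\ge 0$ with $X_n=S$. Then, for every $v\in\mathcal G_N$, $i\in[N]$ and $S\subset[N]$, the time $\tau_S$ is almost surely finite, the random variable $\sum_{n=1}^{\tau_S}\mathrm d_i v(X_{n-1},X_n)$ is integrable, and its expectation $$V_i(S)=\mathbb E\Bigl[\sum_{n=1}^{\tau_S}\mathrm d_i v(X_{n-1},X_n)\Bigr]$$ satisfies $V_i(S)=v_i(S)$. -/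

import Mathlib

open MeasureTheory ProbabilityTheory

noncomputable section

/-- A coalition: a subset of the set of players `[N]`, modelled by `Fin N`. -/
abbrev Coalition (N : ℕ) : Type := Finset (Fin N)

/-- The cooperative games on `[N]`: functions `v` on the coalitions with `v ∅ = 0`. -/
def CoopGame (N : ℕ) : Submodule ℝ (Coalition N → ℝ) where
  carrier := {v | v ∅ = 0}
  add_mem' := by
    intro a b ha hb
    change a ∅ + b ∅ = 0
    rw [show a ∅ = 0 from ha, show b ∅ = 0 from hb, add_zero]
  zero_mem' := rfl
  smul_mem' := by
    intro c a ha
    change c * a ∅ = 0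
    rw [show a ∅ = 0 from ha, mul_zero]

/-- `(S, T)` is an oriented edge of the hypercube graph: `T = S ∪ {i}` for some `i ∉ S`. -/
def IsEdge {N : ℕ} (S T : Coalition N) : Prop := ∃ i : Fin N, i ∉ S ∧ T = insert i S

instance {N : ℕ} (S T : Coalition N) : Decidable (IsEdge S T) :=
  inferInstanceAs (Decidable (∃ i : Fin N, i ∉ S ∧ T = insert i S))

/-- The set of oriented edges of the hypercube graph. -/
abbrev HyperEdge (N : ℕ) : Type := {e : Coalition N × Coalition N // IsEdge e.1 e.2}

/-- `S ∼ T`: one of `(S, T)`, `(T, S)` is an edge. -/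
abbrev Neighbours {N : ℕ} (S T : Coalition N) : Prop := IsEdge S T ∨ IsEdge T S

/-- The value `f (S, T)` of an edge function on a forward-oriented edge, and
`f (S, T) = - f (T, S)` on a reverse-oriented one (and `0` if `S`, `T` are not neighbours). -/
def edgeValue {N : ℕ} (f : HyperEdge N → ℝ) (S T : Coalition N) : ℝ :=
  if h : IsEdge S T then f ⟨(S, T), h⟩
  else if h : IsEdge T S then -f ⟨(T, S), h⟩
  else 0

/-- The gradient `d u (S, T) = u T - u S`. -/
def grad {N : ℕ} (u : Coalition N → ℝ) : HyperEdge N → ℝ :=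
  fun e => u e.1.2 - u e.1.1

/-- The partial gradient `d_i u`: equal to `d u` on the edges `(S, S ∪ {i})`, and `0` on
the edges `(S, S ∪ {j})` with `j ≠ i`. -/
def partialGrad {N : ℕ} (i : Fin N) (u : Coalition N → ℝ) : HyperEdge N → ℝ :=
  fun e => if e.1.2 = insert i e.1.1 then grad u e else 0

/-- The negative divergence `(d* f) (S) = ∑_{T ∼ S} f (T, S)`. -/
def gradAdjoint {N : ℕ} (f : HyperEdge N → ℝ) : Coalition N → ℝ :=
  fun S => ∑ T : Coalition N with Neighbours T S, edgeValue f T S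

theorem not_isEdge_symm {N : ℕ} {S T : Coalition N} (h : IsEdge S T) : ¬ IsEdge T S := by
  obtain ⟨i, hi, rfl⟩ := h
  rintro ⟨j, hj, h⟩
  exact hi (h ▸ Finset.mem_insert_of_mem (Finset.mem_insert_self i S))

/-- `gradAdjoint` is the adjoint of `grad` for the `ℓ²` inner products on vertices and edges. -/
theorem grad_gradAdjoint {N : ℕ} (u : Coalition N → ℝ) (f : HyperEdge N → ℝ) :
    ∑ e, grad u e * f e = ∑ S, u S * gradAdjoint f S := by
  have key : ∀ S T : Coalition N, (if Neighbours T S then edgeValue f T S else 0)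
      = (if h : IsEdge T S then f ⟨(T, S), h⟩ else 0)
        - (if h : IsEdge S T then f ⟨(S, T), h⟩ else 0) := by
    intro S T
    by_cases h : IsEdge T S
    · simp [Neighbours, edgeValue, h, not_isEdge_symm h]
    · by_cases h' : IsEdge S T <;> simp [Neighbours, edgeValue, h, h']
  have conv : ∀ g : HyperEdge N → ℝ, ∑ e, g e
      = ∑ S, ∑ T, (if h : IsEdge S T then g ⟨(S, T), h⟩ else 0) := by
    intro g
    rw [← Fintype.sum_prod_type'
      (f := fun S T : Coalition N => if h : IsEdge S T then g ⟨(S, T), h⟩ else 0),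
      ← Finset.sum_filter_add_sum_filter_not Finset.univ
        (fun e : Coalition N × Coalition N => IsEdge e.1 e.2),
      Finset.sum_eq_zero (s := Finset.univ.filter fun e : Coalition N × Coalition N =>
        ¬ IsEdge e.1 e.2) (by intro e he; simp [(Finset.mem_filter.1 he).2]), add_zero,
      Finset.sum_subtype (p := fun e : Coalition N × Coalition N => IsEdge e.1 e.2) _
        (by simp)]
    exact Finset.sum_congr rfl fun e _ => by simp [e.2]
  have hu : ∀ S, u S * gradAdjoint f S
      = ∑ T, u S * (if h : IsEdge T S then f ⟨(T, S), h⟩ else 0)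
        - ∑ T, u S * (if h : IsEdge S T then f ⟨(S, T), h⟩ else 0) := by
    intro S
    rw [← Finset.sum_sub_distrib, gradAdjoint, Finset.sum_filter, Finset.mul_sum]
    exact Finset.sum_congr rfl fun T _ => by rw [key, mul_sub]
  simp only [hu]
  rw [Finset.sum_sub_distrib, Finset.sum_comm, ← Finset.sum_sub_distrib, conv]
  refine Finset.sum_congr rfl fun S _ => ?_
  rw [← Finset.sum_sub_distrib]
  refine Finset.sum_congr rfl fun T _ => ?_
  by_cases h : IsEdge S T
  · simp [h, grad, sub_mul]
  · simp [h]

/-- `u` solves the least squares equation `d* d u = d* d_i v` that defines the component game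
of player `i` in the game `v`. -/
def IsComponentGame {N : ℕ} (v : CoopGame N) (i : Fin N) (u : CoopGame N) : Prop :=
  gradAdjoint (grad u.1) = gradAdjoint (partialGrad i v.1)

/-- An allocation assigns to every game `v` on `[N]` (for every `N`) and every player
`i ∈ [N]` a game on `[N]`. -/
abbrev Allocation : Type := (N : ℕ) → CoopGame N → Fin N → CoopGame N

/-- `S^{ij}`: the coalition `S` with the players `i` and `j` interchanged. -/
def swapCoalition {N : ℕ} (i j : Fin N) (S : Coalition N) : Coalition N :=
  S.map (Equiv.swap i j).toEmbedding

/-- The game `v^{ij}`, with `v^{ij} (S) = v (S^{ij})`. -/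
def swapGame {N : ℕ} (i j : Fin N) (v : CoopGame N) : CoopGame N :=
  ⟨fun S => v.1 (swapCoalition i j S), v.2⟩

/-- The restriction `v_{-i}` of a game to the players other than `i`, who are relabelled in
increasing order by `i.succAbove`. -/
def restrictGame {N : ℕ} (i : Fin (N + 1)) (v : CoopGame (N + 1)) : CoopGame N :=
  ⟨fun S => v.1 (S.map i.succAboveEmb), v.2⟩

/-- The extended Shapley axioms. -/
structure ExtendedShapleyAxioms (Φ : Allocation) : Prop where
  efficiency : ∀ (N : ℕ) (v : CoopGame N), v = ∑ i, Φ N v i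
  symmetry : ∀ (N : ℕ) (v : CoopGame N) (i j : Fin N) (S : Coalition N),
    (Φ N (swapGame i j v) i).1 (swapCoalition i j S) = (Φ N v j).1 S
  null_player : ∀ (N : ℕ) (v : CoopGame (N + 1)) (i : Fin (N + 1)), partialGrad i v.1 = 0 →
    Φ (N + 1) v i = 0 ∧
    ∀ (j : Fin N) (S : Coalition N),
      (Φ (N + 1) v (i.succAbove j)).1 (insert i (S.map i.succAboveEmb))
        = (Φ (N + 1) v (i.succAbove j)).1 (S.map i.succAboveEmb) ∧
      (Φ (N + 1) v (i.succAbove j)).1 (S.map i.succAboveEmb)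
        = (Φ N (restrictGame i v) j).1 S
  linearity : ∀ (N : ℕ) (v v' : CoopGame N) (α α' : ℝ) (i : Fin N),
    Φ N (α • v + α' • v') i = α • Φ N v i + α' • Φ N v' i
  reflection : ∀ (N : ℕ) (v : CoopGame N) (i : Fin N) (S T : Coalition N), i ∉ S → i ∉ T →
    (Φ N v i).1 (insert i S) - (Φ N v i).1 (insert i T) = -((Φ N v i).1 S - (Φ N v i).1 T)

/-- The transition probabilities of the simple random walk on the hypercube graph. -/
def walkTransition {N : ℕ} (S T : Coalition N) : ℝ :=
  if Neighbours S T then 1 / (N : ℝ) else 0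

/-- `X` is, under `P`, a Markov chain on the coalitions, started at `∅`, with transition
probabilities `walkTransition`. -/
structure IsCoalitionWalk {N : ℕ} {Ω : Type*} [MeasurableSpace Ω] (P : Measure Ω)
    (X : ℕ → Ω → Coalition N) : Prop where
  measurable : ∀ (n : ℕ) (S : Coalition N), MeasurableSet {ω | X n ω = S}
  start : ∀ᵐ ω ∂P, X 0 ω = ∅
  markov : ∀ (n : ℕ) (s : ℕ → Coalition N),
    P.real {ω | ∀ k ≤ n + 1, X k ω = s k}
      = P.real {ω | ∀ k ≤ n, X k ω = s k} * walkTransition (s n) (s (n + 1))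

/-- The first time `τ_S` at which the process visits `S` (`⊤` if it never does). -/
def firstVisit {N : ℕ} {Ω : Type*} (X : ℕ → Ω → Coalition N) (S : Coalition N) :
    Ω → WithTop ℕ :=
  hittingAfter X {S} 0

/-- The total contribution `∑_{n=1}^{τ_S} d_i v (X_{n-1}, X_n)` of player `i` along the path
up to the first visit to `S` (with the value `0` where `S` is never visited). -/
def pathContribution {N : ℕ} {Ω : Type*} (X : ℕ → Ω → Coalition N) (v : CoopGame N)
    (i : Fin N) (S : Coalition N) : Ω → ℝ :=
  fun ω => ∑ n ∈ Finset.Icc 1 ((firstVisit X S ω).untopD 0),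
    edgeValue (partialGrad i v.1) (X (n - 1) ω) (X n ω)

/-- The value `V_i (S) = 𝔼[∑_{n=1}^{τ_S} d_i v (X_{n-1}, X_n)]`. -/
def pathValue {N : ℕ} {Ω : Type*} [MeasurableSpace Ω] (P : Measure Ω)
    (X : ℕ → Ω → Coalition N) (v : CoopGame N) (i : Fin N) (S : Coalition N) : ℝ :=
  ∫ ω, pathContribution X v i S ω ∂P

end

/-!
Since `d* d u S = ∑ k, (u S - u (S △ {k}))` and `d* d_i v S = v S - v (S △ {i})`, the component
game of player `i` is the solution of a Poisson equation on the hypercube. A harmonic function has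
zero energy and is constant (`eq_of_harmonic`), so the Laplacian is injective on games, and by
counting dimensions every right-hand side of total mass zero is attained (`exists_laplacian_eq`).
Efficiency, symmetry, linearity and the null player axiom hold for the component games because both
sides solve the same Poisson equation, and reflection because `S ↦ v_i S + v_i (S △ {i})` is
harmonic.

For uniqueness (`ExtendedShapleyAxioms.unique`) one inducts on the number of players. Replacing
`w` by `w - (S ↦ w (S \ {i}))` for all players `i` in turn shows that every game is a sum of games
with a null player and a game carried by the grand coalition (`mem_of_null_of_univ`). The former
are settled by the null player axiom and the induction hypothesis. On the latter, the difference
of two allocations is a symmetric family that shares out the zero game and satisfies the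
reflection axiom; an induction on coalitions shows that such a family vanishes
(`eq_zero_of_symmetric`).

For the random walk, write a path sum as `∑ n, 1_{n < τ_S} G (X_n, X_{n+1})`. By the Markov
property the expectation of a term depends on `G` only through the sums
`∑ k, G (T, T △ {k})` with `T ≠ S` (`IsCoalitionWalk.integral_stepTerm_congr`). This is used twice.
If `u` solves a Poisson equation with constant right-hand side off `S`, then `G = 1` may be
replaced by the increments of `u`, which telescope and are bounded: hence `τ_S` has finite
expectation (`IsCoalitionWalk.tsum_measure_notVisited_ne_top`), and all path sums of bounded `G`
are integrable, with termwise expectation. By the equation of the component game, `G = d_i v` may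
be replaced by the increments of `v_i`, whose path sum is `v_i S - v_i ∅ = v_i S`.
-/

/-! ### The Laplacian of the hypercube -/

/-- The neighbour of `S` across the direction `k`: player `k` leaves `S` if `k ∈ S`, and joins it
otherwise. -/
def toggle {N : ℕ} (k : Fin N) (S : Coalition N) : Coalition N :=
  if k ∈ S then S.erase k else insert k S

section toggle

variable {N : ℕ} {k l : Fin N} {S T : Coalition N}

theorem toggle_of_mem (h : k ∈ S) : toggle k S = S.erase k := if_pos h

theorem toggle_of_notMem (h : k ∉ S) : toggle k S = insert k S := if_neg h

theorem mem_toggle : l ∈ toggle k S ↔ (if l = k then l ∉ S else l ∈ S) := by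
  unfold toggle
  split_ifs <;> grind

theorem toggle_toggle : toggle k (toggle k S) = S := by
  ext a; simp only [mem_toggle]; grind

theorem toggle_comm : toggle k (toggle l S) = toggle l (toggle k S) := by
  ext a; simp only [mem_toggle]; grind

theorem toggle_left_injective : Function.Injective fun k : Fin N => toggle k S := by
  intro k l h
  have := congrArg (k ∈ ·) h
  simp only [mem_toggle] at this
  by_contra hne
  simp [hne] at this

theorem isEdge_insert (h : k ∉ S) : IsEdge S (insert k S) := ⟨k, h, rfl⟩

theorem isEdge_erase (h : k ∈ S) : IsEdge (S.erase k) S :=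
  ⟨k, by simp, (Finset.insert_erase h).symm⟩

theorem neighbours_iff : Neighbours S T ↔ ∃ k, toggle k S = T := by
  constructor
  · rintro (⟨k, hk, rfl⟩ | ⟨k, hk, rfl⟩)
    · exact ⟨k, toggle_of_notMem hk⟩
    · exact ⟨k, by rw [toggle_of_mem (Finset.mem_insert_self k T), Finset.erase_insert hk]⟩
  · rintro ⟨k, rfl⟩
    by_cases hk : k ∈ S
    · rw [toggle_of_mem hk]; exact Or.inr (isEdge_erase hk)
    · rw [toggle_of_notMem hk]; exact Or.inl (isEdge_insert hk)

theorem neighbours_comm : Neighbours S T ↔ Neighbours T S := or_comm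

theorem sum_neighbours (S : Coalition N) (f : Coalition N → ℝ) :
    ∑ T with Neighbours S T, f T = ∑ k, f (toggle k S) := by
  have : (Finset.univ.filter fun T => Neighbours S T)
      = Finset.univ.image fun k => toggle k S := by
    ext T; simp [neighbours_iff]
  rw [this, Finset.sum_image (toggle_left_injective.injOn)]

theorem edgeValue_grad_toggle (u : Coalition N → ℝ) (k : Fin N) (S : Coalition N) :
    edgeValue (grad u) S (toggle k S) = u (toggle k S) - u S := by
  by_cases hk : k ∈ S
  · rw [toggle_of_mem hk, edgeValue, dif_neg (not_isEdge_symm (isEdge_erase hk)),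
      dif_pos (isEdge_erase hk)]
    simp [grad]
  · rw [toggle_of_notMem hk, edgeValue, dif_pos (isEdge_insert hk)]
    rfl

theorem edgeValue_partialGrad_toggle (v : Coalition N → ℝ) (i k : Fin N) (S : Coalition N) :
    edgeValue (partialGrad i v) S (toggle k S)
      = if k = i then v (toggle k S) - v S else 0 := by
  by_cases hk : k ∈ S
  · rw [toggle_of_mem hk, edgeValue, dif_neg (not_isEdge_symm (isEdge_erase hk)),
      dif_pos (isEdge_erase hk)]
    have : S = insert i (S.erase k) ↔ k = i := by
      constructor
      · intro h
        have := h ▸ hk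
        simp at this
        exact this
      · rintro rfl; exact (Finset.insert_erase hk).symm
    simp only [partialGrad, this, grad]
    split_ifs <;> simp
  · rw [toggle_of_notMem hk, edgeValue, dif_pos (isEdge_insert hk)]
    have : insert k S = insert i S ↔ k = i := by
      constructor
      · intro h
        have : k ∈ insert i S := h ▸ Finset.mem_insert_self k S
        simpa [hk] using this
      · rintro rfl; rfl
    simp only [partialGrad, this, grad]

theorem edgeValue_zero (S T : Coalition N) : edgeValue (0 : HyperEdge N → ℝ) S T = 0 := by
  simp [edgeValue]

theorem edgeValue_comm (f : HyperEdge N → ℝ) (S T : Coalition N) :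
    edgeValue f T S = - edgeValue f S T := by
  unfold edgeValue
  by_cases h : IsEdge S T
  · simp [h, not_isEdge_symm h]
  · by_cases h' : IsEdge T S <;> simp [h, h']

theorem gradAdjoint_eq_sum_toggle (f : HyperEdge N → ℝ) (S : Coalition N) :
    gradAdjoint f S = -∑ k, edgeValue f S (toggle k S) := by
  rw [gradAdjoint, ← sum_neighbours S, ← Finset.sum_neg_distrib]
  simp only [neighbours_comm (T := S)]
  exact Finset.sum_congr rfl fun T _ => edgeValue_comm f S T

theorem gradAdjoint_grad (u : Coalition N → ℝ) (S : Coalition N) :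
    gradAdjoint (grad u) S = ∑ k, (u S - u (toggle k S)) := by
  simp [gradAdjoint_eq_sum_toggle, edgeValue_grad_toggle]

theorem gradAdjoint_partialGrad (v : Coalition N → ℝ) (i : Fin N) (S : Coalition N) :
    gradAdjoint (partialGrad i v) S = v S - v (toggle i S) := by
  simp [gradAdjoint_eq_sum_toggle, edgeValue_partialGrad_toggle]

/-- The least squares equation, read at one coalition at a time. -/
theorem isComponentGame_iff {v : CoopGame N} {i : Fin N} {u : CoopGame N} :
    IsComponentGame v i u ↔
      ∀ S, ∑ k, (u.1 S - u.1 (toggle k S)) = v.1 S - v.1 (toggle i S) := by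
  simp only [IsComponentGame, funext_iff, gradAdjoint_grad, gradAdjoint_partialGrad]

theorem partialGrad_eq_zero_iff {v : Coalition N → ℝ} {i : Fin N} :
    partialGrad i v = 0 ↔ ∀ S, v (toggle i S) = v S := by
  constructor
  · intro h S
    have := edgeValue_partialGrad_toggle v i i S
    rw [h, if_pos rfl] at this
    rw [edgeValue_zero] at this
    linarith
  · intro h
    ext ⟨⟨S, T⟩, k, hk, hT⟩
    simp only at hk hT
    subst hT
    have := edgeValue_partialGrad_toggle v i k S
    rw [toggle_of_notMem hk, edgeValue, dif_pos (isEdge_insert hk)] at this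
    rw [this]
    change _ = (0 : ℝ)
    split_ifs with hki
    · rw [← toggle_of_notMem hk, hki, h, sub_self]
    · rfl

/-- A function on the hypercube with vanishing gradient is constant. -/
theorem eq_of_forall_toggle {u : Coalition N → ℝ} (h : ∀ k S, u (toggle k S) = u S)
    (S : Coalition N) : u S = u ∅ := by
  induction S using Finset.induction_on with
  | empty => rfl
  | insert k S hk ih => rw [← toggle_of_notMem hk, h, ih]

/-- The energy of a harmonic function vanishes, so it is constant. -/
theorem eq_of_harmonic {u : Coalition N → ℝ} (h : ∀ S, ∑ k, (u S - u (toggle k S)) = 0)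
    (S : Coalition N) : u S = u ∅ := by
  have hE : ∑ e, grad u e * grad u e = 0 := by
    rw [grad_gradAdjoint]
    simp [gradAdjoint_grad, h]
  have hg : ∀ e, grad u e = 0 := fun e => by
    have := (Finset.sum_eq_zero_iff_of_nonneg fun e _ => mul_self_nonneg (grad u e)).1 hE e
      (Finset.mem_univ e)
    exact mul_self_eq_zero.1 this
  refine eq_of_forall_toggle (fun k S => ?_) S
  have h0 := edgeValue_grad_toggle u k S
  rw [show grad u = 0 from funext hg, edgeValue_zero] at h0
  linarith

theorem CoopGame.eq_of_laplacian_eq {u w : CoopGame N}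
    (h : ∀ S, ∑ k, (u.1 S - u.1 (toggle k S)) = ∑ k, (w.1 S - w.1 (toggle k S))) : u = w := by
  refine Subtype.ext (funext fun S => ?_)
  have := eq_of_harmonic (u := u.1 - w.1) (fun S => by
    rw [← sub_eq_zero.2 (h S), ← Finset.sum_sub_distrib]
    exact Finset.sum_congr rfl fun k _ => by simp only [Pi.sub_apply]; ring) S
  have hu : u.1 ∅ = 0 := u.2
  have hw : w.1 ∅ = 0 := w.2
  simp only [Pi.sub_apply, hu, hw] at this
  linarith

/-- Poisson's equation on the hypercube is solvable for every right-hand side of total mass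
zero: the Laplacian is injective on games, and the dimensions agree. -/
theorem exists_laplacian_eq (g : Coalition N → ℝ) (hg : ∑ S, g S = 0) :
    ∃ u : CoopGame N, ∀ S, ∑ k, (u.1 S - u.1 (toggle k S)) = g S := by
  let pairing : (Coalition N → ℝ) →ₗ[ℝ] CoopGame N →ₗ[ℝ] ℝ :=
    LinearMap.mk₂ ℝ (fun f w => ∑ S, f S * w.1 S)
      (fun f f' w => by simp [add_mul, Finset.sum_add_distrib])
      (fun c f w => by simp [mul_assoc, Finset.mul_sum])
      (fun f w w' => by simp [mul_add, Finset.sum_add_distrib])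
      (fun c f w => by simp [mul_left_comm, Finset.mul_sum])
  let lap : CoopGame N →ₗ[ℝ] (Coalition N → ℝ) :=
    { toFun := fun u S => ∑ k, (u.1 S - u.1 (toggle k S))
      map_add' := fun u w => by
        ext S
        simp only [Submodule.coe_add, Pi.add_apply, ← Finset.sum_add_distrib]
        exact Finset.sum_congr rfl fun k _ => by ring
      map_smul' := fun c u => by
        ext S
        simp only [Submodule.coe_smul, Pi.smul_apply, smul_eq_mul, Finset.mul_sum,
          RingHom.id_apply]
        exact Finset.sum_congr rfl fun k _ => by ring }
  -- a function of total mass zero that pairs to zero with every game vanishes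
  have key : ∀ f : Coalition N → ℝ, ∑ S, f S = 0 → pairing f = 0 → f = 0 := by
    intro f hf h
    have hne : ∀ S, S ≠ ∅ → f S = 0 := by
      intro S hS
      have := LinearMap.congr_fun h ⟨Pi.single S 1, by
        change (Pi.single S (1 : ℝ) : Coalition N → ℝ) ∅ = 0
        simp [hS.symm]⟩
      simpa [pairing, Pi.single_apply] using this
    ext S
    by_cases hS : S = ∅
    · rw [Finset.sum_eq_single ∅ (fun T _ hT => hne T hT) (by simp)] at hf
      rw [hS, hf]; rfl
    · exact hne S hS
  have hmass : ∀ u : CoopGame N, ∑ S, lap u S = 0 := by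
    intro u
    have := grad_gradAdjoint (fun _ => 1) (grad u.1)
    simpa [gradAdjoint_grad, grad, lap] using this.symm
  have hinj : Function.Injective (pairing ∘ₗ lap) := by
    rw [← LinearMap.ker_eq_bot, LinearMap.ker_eq_bot']
    intro u hu
    have h0 := key (lap u) (hmass u) hu
    refine CoopGame.eq_of_laplacian_eq fun S => ?_
    have := congrFun h0 S
    simpa [lap] using this
  have hsurj : Function.Surjective (pairing ∘ₗ lap) :=
    (LinearMap.injective_iff_surjective_of_finrank_eq_finrank
      Subspace.dual_finrank_eq.symm).1 hinj
  obtain ⟨u, hu⟩ := hsurj (pairing g)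
  refine ⟨u, fun S => ?_⟩
  have := key (lap u - g) (by simp [hmass, hg]) (by
    rw [map_sub, sub_eq_zero]; exact hu)
  exact sub_eq_zero.1 (congrFun this S)

theorem sum_toggle (k : Fin N) (f : Coalition N → ℝ) : ∑ S, f (toggle k S) = ∑ S, f S :=
  Equiv.sum_comp (Function.Involutive.toPerm (toggle k) fun _ => toggle_toggle) f

theorem exists_isComponentGame (v : CoopGame N) (i : Fin N) :
    ∃ u, IsComponentGame v i u := by
  obtain ⟨u, hu⟩ := exists_laplacian_eq (fun S => v.1 S - v.1 (toggle i S)) (by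
    rw [Finset.sum_sub_distrib, sum_toggle, sub_self])
  exact ⟨u, isComponentGame_iff.2 hu⟩

end toggle

/-- The component game of player `i` in the game `v`. -/
noncomputable def componentGame : Allocation := fun _ v i => (exists_isComponentGame v i).choose

section componentGame

variable {N : ℕ}

theorem componentGame_eq (v : CoopGame N) (i : Fin N) (S : Coalition N) :
    ∑ k, ((componentGame N v i).1 S - (componentGame N v i).1 (toggle k S))
      = v.1 S - v.1 (toggle i S) :=
  isComponentGame_iff.1 (exists_isComponentGame v i).choose_spec S

theorem isComponentGame_iff_eq {v : CoopGame N} {i : Fin N} {u : CoopGame N} :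
    IsComponentGame v i u ↔ u = componentGame N v i := by
  constructor
  · intro h
    refine CoopGame.eq_of_laplacian_eq fun S => ?_
    rw [isComponentGame_iff.1 h, componentGame_eq]
  · rintro rfl
    exact (exists_isComponentGame v i).choose_spec

theorem eq_componentGame {v : CoopGame N} {i : Fin N} {u : CoopGame N}
    (h : ∀ S, ∑ k, (u.1 S - u.1 (toggle k S)) = v.1 S - v.1 (toggle i S)) :
    componentGame N v i = u :=
  (isComponentGame_iff_eq.1 (isComponentGame_iff.2 h)).symm

end componentGame

/-! ### The component games satisfy the axioms -/

theorem map_toggle {M N : ℕ} (e : Fin M ↪ Fin N) (k : Fin M) (S : Coalition M) :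
    (toggle k S).map e = toggle (e k) (S.map e) := by
  by_cases hk : k ∈ S
  · rw [toggle_of_mem hk, toggle_of_mem (Finset.mem_map_of_mem e hk), Finset.map_erase]
  · rw [toggle_of_notMem hk, toggle_of_notMem (by simpa using hk), Finset.map_insert]

section swap

variable {N : ℕ} (i j k : Fin N) (S : Coalition N)

theorem swapCoalition_toggle :
    swapCoalition i j (toggle k S) = toggle (Equiv.swap i j k) (swapCoalition i j S) :=
  map_toggle _ k S

theorem mem_swapCoalition {i j k : Fin N} {S : Coalition N} :
    k ∈ swapCoalition i j S ↔ Equiv.swap i j k ∈ S := by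
  simp [swapCoalition, Finset.mem_map_equiv]

theorem swapCoalition_swapCoalition : swapCoalition i j (swapCoalition i j S) = S := by
  ext a; simp [mem_swapCoalition]

/-- Interchanging two players that are both inside or both outside a coalition fixes it. -/
theorem swapCoalition_eq_self {i j : Fin N} {S : Coalition N} (h : i ∈ S ↔ j ∈ S) :
    swapCoalition i j S = S := by
  ext a
  rw [mem_swapCoalition, Equiv.swap_apply_def]
  split_ifs with h1 h2
  · rw [h1, h]
  · rw [h2, h]
  · rfl

end swap

section restrict

variable {N : ℕ}

/-- The trace of a coalition on the players other than `i`, relabelled in increasing order. -/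
def traceCoalition (i : Fin (N + 1)) (S : Coalition (N + 1)) : Coalition N :=
  Finset.univ.filter fun j => i.succAbove j ∈ S

variable (i : Fin (N + 1)) (j : Fin N)

theorem mem_traceCoalition {i : Fin (N + 1)} {j : Fin N} {S : Coalition (N + 1)} :
    j ∈ traceCoalition i S ↔ i.succAbove j ∈ S := by
  simp [traceCoalition]

theorem traceCoalition_map (S : Coalition N) :
    traceCoalition i (S.map i.succAboveEmb) = S := by
  ext j
  rw [mem_traceCoalition]
  exact Finset.mem_map' i.succAboveEmb

theorem traceCoalition_toggle_self (S : Coalition (N + 1)) :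
    traceCoalition i (toggle i S) = traceCoalition i S := by
  ext j
  simp [mem_traceCoalition, mem_toggle, Fin.succAbove_ne]

theorem traceCoalition_toggle (S : Coalition (N + 1)) :
    traceCoalition i (toggle (i.succAbove j) S) = toggle j (traceCoalition i S) := by
  ext k
  simp [mem_traceCoalition, mem_toggle]

theorem notMem_map_succAboveEmb (S : Coalition N) : i ∉ S.map i.succAboveEmb := by
  simp [Fin.succAbove_ne]

theorem map_traceCoalition (S : Coalition (N + 1)) :
    (traceCoalition i S).map i.succAboveEmb = S.erase i := by
  ext k
  rcases Fin.eq_self_or_eq_succAbove i k with rfl | ⟨j, rfl⟩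
  · simp [Fin.succAbove_ne]
  · have := Finset.mem_map' (s := traceCoalition i S) i.succAboveEmb (a := j)
    rw [Fin.succAboveEmb_apply] at this
    rw [this, mem_traceCoalition]
    simp [Fin.succAbove_ne]

theorem eq_erase_of_null {v : CoopGame (N + 1)} (h : ∀ S, v.1 (toggle i S) = v.1 S)
    (S : Coalition (N + 1)) : v.1 (S.erase i) = v.1 S := by
  by_cases hi : i ∈ S
  · rw [← toggle_of_mem hi, h]
  · rw [Finset.erase_eq_of_notMem hi]

/-- A game on the players other than `i`, extended to all players by letting `i` contribute
nothing. -/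
def extendGame (i : Fin (N + 1)) (w : CoopGame N) : CoopGame (N + 1) :=
  ⟨fun S => w.1 (traceCoalition i S), by
    change w.1 (traceCoalition i ∅) = 0
    rw [show traceCoalition i ∅ = ∅ by simp [traceCoalition]]
    exact w.2⟩

/-- Adding a null player `i` does not change the component games of the other players. -/
theorem componentGame_of_null {v : CoopGame (N + 1)} (h : ∀ S, v.1 (toggle i S) = v.1 S) :
    componentGame (N + 1) v (i.succAbove j)
      = extendGame i (componentGame N (restrictGame i v) j) := by
  refine eq_componentGame fun S => ?_
  rw [Fin.sum_univ_succAbove _ i]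
  simp only [extendGame, traceCoalition_toggle_self, traceCoalition_toggle, sub_self, zero_add,
    componentGame_eq]
  simp only [restrictGame, ← traceCoalition_toggle, map_traceCoalition, eq_erase_of_null i h]

end restrict

section axioms_hold

variable {N : ℕ}

theorem componentGame_efficiency (v : CoopGame N) : v = ∑ i, componentGame N v i := by
  refine CoopGame.eq_of_laplacian_eq fun S => ?_
  have : ∀ T, (∑ i, componentGame N v i).1 T = ∑ i, (componentGame N v i).1 T := fun T => by
    simp
  simp only [this, ← Finset.sum_sub_distrib]
  rw [Finset.sum_comm]
  simp only [componentGame_eq]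

theorem componentGame_swapGame (v : CoopGame N) (i j : Fin N) :
    componentGame N (swapGame i j v) i = swapGame i j (componentGame N v j) := by
  refine eq_componentGame fun S => ?_
  simp only [swapGame, swapCoalition_toggle, Equiv.swap_apply_left]
  rw [← componentGame_eq]
  exact Equiv.sum_comp (Equiv.swap i j) fun k =>
    (componentGame N v j).1 (swapCoalition i j S)
      - (componentGame N v j).1 (toggle k (swapCoalition i j S))

theorem componentGame_linear (v v' : CoopGame N) (α α' : ℝ) (i : Fin N) :
    componentGame N (α • v + α' • v') i
      = α • componentGame N v i + α' • componentGame N v' i := by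
  refine eq_componentGame fun S => ?_
  have h := componentGame_eq v i S
  have h' := componentGame_eq v' i S
  simp only [Submodule.coe_add, Submodule.coe_smul, Pi.add_apply, Pi.smul_apply, smul_eq_mul]
  calc _ = α * (v.1 S - v.1 (toggle i S)) + α' * (v'.1 S - v'.1 (toggle i S)) := by
        rw [← h, ← h', Finset.mul_sum, Finset.mul_sum, ← Finset.sum_add_distrib]
        exact Finset.sum_congr rfl fun k _ => by ring
    _ = _ := by ring

/-- The right-hand side of the equation of `v_i` is odd under the reflection `toggle i`, so the
even part of `v_i` is harmonic, hence constant. -/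
theorem componentGame_add_toggle (v : CoopGame N) (i : Fin N) (S : Coalition N) :
    (componentGame N v i).1 S + (componentGame N v i).1 (toggle i S)
      = (componentGame N v i).1 ∅ + (componentGame N v i).1 (toggle i ∅) := by
  refine eq_of_harmonic
    (u := fun S => (componentGame N v i).1 S + (componentGame N v i).1 (toggle i S))
    (fun S => ?_) S
  have h := componentGame_eq v i S
  have h' := componentGame_eq v i (toggle i S)
  rw [toggle_toggle] at h'
  calc _ = (v.1 S - v.1 (toggle i S)) + (v.1 (toggle i S) - v.1 S) := by
        rw [← h, ← h', ← Finset.sum_add_distrib]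
        exact Finset.sum_congr rfl fun k _ => by rw [toggle_comm (k := i)]; ring
    _ = 0 := by ring

end axioms_hold

theorem extendedShapleyAxioms_componentGame : ExtendedShapleyAxioms componentGame where
  efficiency _ v := componentGame_efficiency v
  symmetry N v i j S := by
    rw [componentGame_swapGame]
    simp only [swapGame, swapCoalition_swapCoalition]
  null_player N v i hi := by
    rw [partialGrad_eq_zero_iff] at hi
    refine ⟨eq_componentGame fun S => by simp [hi], fun j S => ?_⟩
    rw [componentGame_of_null i j hi,
      ← toggle_of_notMem (notMem_map_succAboveEmb i S)]
    simp only [extendGame, traceCoalition_toggle_self, traceCoalition_map, and_self]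
  linearity _ v v' α α' i := componentGame_linear v v' α α' i
  reflection N v i S T hS hT := by
    have h1 := componentGame_add_toggle v i S
    have h2 := componentGame_add_toggle v i T
    rw [toggle_of_notMem hS] at h1
    rw [toggle_of_notMem hT] at h2
    linarith

/-! ### The axioms determine the allocation -/

section uniqueness

variable {N : ℕ} {f : Fin N → Coalition N → ℝ} {C : ℝ}

/-- Consider a symmetric family that shares out the zero game and satisfies the reflection axiom,
and suppose that the worth `C` of a single player to himself is nonnegative. Then every coalition
is worth at least `C` to each of its members, by induction on the coalition: the members of `S`
get at least nothing, so the others get at most nothing, and reflection turns this into the lower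
bound for `S ∪ {k}`. At the grand coalition all worths add up to zero, so that `C = 0`. -/
theorem nonneg_of_symmetric
    (hsymm : ∀ S k l, (k ∈ S ↔ l ∈ S) → f k S = f l S)
    (hsum : ∀ S, ∑ k, f k S = 0)
    (hrefl : ∀ k S, k ∉ S → f k (insert k S) + f k S = C) (hC : 0 ≤ C)
    (h0 : ∀ k, f k ∅ = 0) {k : Fin N} {S : Coalition N} (hk : k ∈ S) : C = 0 ∧ 0 ≤ f k S := by
  have hle : ∀ S : Coalition N, ∀ k ∉ S, C ≤ f k (insert k S) := by
    intro S
    induction S using Finset.induction_on with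
    | empty => intro k hk; linarith [hrefl k ∅ hk, h0 k]
    | insert l S hl ih =>
      intro k hk
      have hlS := ih l hl
      have hk0 : f k (insert l S) ≤ 0 := by
        by_contra! hpos
        have : 0 < ∑ m, f m (insert l S) := by
          refine Finset.sum_pos' (fun m _ => ?_) ⟨k, Finset.mem_univ k, hpos⟩
          by_cases hm : m ∈ insert l S
          · rw [hsymm _ m l (by simpa using hm)]; linarith
          · rw [hsymm _ m k (by simp only [hm, hk])]; exact hpos.le
        exact this.ne' (hsum _)
      linarith [hrefl k _ hk]
  have hmem : ∀ S : Coalition N, ∀ k ∈ S, C ≤ f k S := fun S k hk => by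
    have := hle (S.erase k) k (by simp)
    rwa [Finset.insert_erase hk] at this
  have huniv : f k Finset.univ = 0 :=
    (Finset.sum_eq_zero_iff_of_nonneg fun l _ =>
      hC.trans (hmem _ l (Finset.mem_univ l))).1 (hsum _) k (Finset.mem_univ k)
  exact ⟨le_antisymm (huniv ▸ hmem _ k (Finset.mem_univ k)) hC, hC.trans (hmem S k hk)⟩

/-- A symmetric family that shares out the zero game and satisfies the reflection axiom
vanishes. -/
theorem eq_zero_of_symmetric
    (hsymm : ∀ S k l, (k ∈ S ↔ l ∈ S) → f k S = f l S)
    (hsum : ∀ S, ∑ k, f k S = 0)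
    (hrefl : ∀ k S, k ∉ S → f k (insert k S) + f k S = C)
    (h0 : ∀ k, f k ∅ = 0) (k : Fin N) (S : Coalition N) : f k S = 0 := by
  have hpos : 0 ≤ C → ∀ {k : Fin N} {S : Coalition N}, k ∈ S → C = 0 ∧ 0 ≤ f k S :=
    fun hC _ _ hk => nonneg_of_symmetric hsymm hsum hrefl hC h0 hk
  have hneg : C ≤ 0 → ∀ {k : Fin N} {S : Coalition N}, k ∈ S → C = 0 ∧ f k S ≤ 0 := by
    intro hC k S hk
    have := nonneg_of_symmetric (f := fun k S => -f k S) (C := -C)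
      (fun S k l h => by rw [hsymm S k l h]) (fun S => by simp [hsum])
      (fun k S hk => by linarith [hrefl k S hk]) (by linarith) (fun k => by simp [h0]) hk
    exact ⟨by linarith [this.1], by linarith [this.2]⟩
  have hC : C = 0 := by
    rcases le_total 0 C with h | h
    · exact (hpos h (Finset.mem_univ k)).1
    · exact (hneg h (Finset.mem_univ k)).1
  have hin : ∀ {S : Coalition N}, k ∈ S → f k S = 0 := fun hk =>
    le_antisymm (hneg hC.le hk).2 (hpos hC.ge hk).2
  by_cases hk : k ∈ S
  · exact hin hk
  · linarith [hrefl k S hk, hin (Finset.mem_insert_self k S)]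

/-- Two allocations that satisfy the axioms agree on the games that treat all players alike. -/
theorem ExtendedShapleyAxioms.eq_of_swapGame_eq {Φ Ψ : Allocation}
    (hΦ : ExtendedShapleyAxioms Φ) (hΨ : ExtendedShapleyAxioms Ψ) {v : CoopGame N}
    (hv : ∀ i j, swapGame i j v = v) (k : Fin N) : Φ N v k = Ψ N v k := by
  have hswap : ∀ {Φ : Allocation}, ExtendedShapleyAxioms Φ → ∀ k l S,
      (Φ N v k).1 (swapCoalition k l S) = (Φ N v l).1 S := fun hΦ k l S => by
    have := hΦ.symmetry N v k l S
    rwa [hv] at this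
  have hsum : ∀ {Φ : Allocation}, ExtendedShapleyAxioms Φ → ∀ S,
      ∑ k, (Φ N v k).1 S = v.1 S := fun {Φ} hΦ S => by
    conv_rhs => rw [hΦ.efficiency N v]
    simp
  have hempty : ∀ w : CoopGame N, w.1 ∅ = 0 := fun w => w.2
  have hsingle : ∀ {Φ : Allocation}, ExtendedShapleyAxioms Φ → ∀ k l,
      (Φ N v k).1 {k} = (Φ N v l).1 {l} := fun hΦ k l => by
    rw [← hswap hΦ k l, show swapCoalition k l {l} = {k} by simp [swapCoalition]]
  refine Subtype.ext (funext fun S => sub_eq_zero.1 ?_)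
  refine eq_zero_of_symmetric (f := fun k S => (Φ N v k).1 S - (Ψ N v k).1 S)
    (C := (Φ N v k).1 {k} - (Ψ N v k).1 {k}) (fun S k l h => ?_) (fun S => ?_)
    (fun l S hl => ?_) (fun l => by simp only [hempty, sub_self]) k S
  · rw [← hswap hΦ k l S, ← hswap hΨ k l S, swapCoalition_eq_self h]
  · rw [Finset.sum_sub_distrib, hsum hΦ, hsum hΨ, sub_self]
  · have h1 := hΦ.reflection N v l S ∅ hl (by simp)
    have h2 := hΨ.reflection N v l S ∅ hl (by simp)
    simp only [hempty, insert_empty_eq] at h1 h2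
    rw [hsingle hΦ k l, hsingle hΨ k l]
    linarith

/-- A family of games that is closed under sums, and contains the games with a null player and the
games carried by the grand coalition, contains every game. Indeed
`w ↦ w - (S ↦ w (S \ {i}))` changes `w` by a game in which `i` is null, and turns it into a game
that vanishes on the coalitions without `i`; these operations are applied for all players. -/
theorem mem_of_null_of_univ {K : Set (CoopGame N)}
    (hadd : ∀ v ∈ K, ∀ w ∈ K, v + w ∈ K)
    (hnull : ∀ v : CoopGame N, ∀ i, (∀ S, v.1 (toggle i S) = v.1 S) → v ∈ K)
    (huniv : ∀ v : CoopGame N, (∀ S, S ≠ Finset.univ → v.1 S = 0) → v ∈ K)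
    (v : CoopGame N) : v ∈ K := by
  have key : ∀ A : Finset (Fin N), ∃ w z : CoopGame N,
      (∀ S, ¬ A ⊆ S → w.1 S = 0) ∧ z ∈ K ∧ v = z + w := by
    intro A
    induction A using Finset.induction_on with
    | empty =>
      exact ⟨v, 0, by simp, huniv 0 fun _ _ => rfl, (zero_add v).symm⟩
    | insert i A hi ih =>
      obtain ⟨w, z, hw, hz, hv⟩ := ih
      let p : CoopGame N := ⟨fun S => w.1 (S.erase i), by
        change w.1 (Finset.erase ∅ i) = 0
        rw [Finset.erase_empty]; exact w.2⟩
      refine ⟨w - p, z + p, fun S hS => ?_, hadd z hz p (hnull p i fun S => ?_), ?_⟩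
      · change w.1 S - w.1 (S.erase i) = 0
        by_cases hiS : i ∈ S
        · have hA : ¬ A ⊆ S := fun h => hS (Finset.insert_subset hiS h)
          rw [hw S hA, hw _ fun h => hA (h.trans (Finset.erase_subset i S)), sub_self]
        · rw [Finset.erase_eq_of_notMem hiS, sub_self]
      · change w.1 ((toggle i S).erase i) = w.1 (S.erase i)
        refine congrArg w.1 (Finset.ext fun a => ?_)
        by_cases ha : a = i <;> simp [ha, mem_toggle]
      · rw [hv]; abel
  obtain ⟨w, z, hw, hz, rfl⟩ := key Finset.univ
  exact hadd z hz w (huniv w fun S hS => hw S (by rwa [Finset.univ_subset_iff]))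

theorem ExtendedShapleyAxioms.map_add {Φ : Allocation} (hΦ : ExtendedShapleyAxioms Φ)
    (v w : CoopGame N) (i : Fin N) : Φ N (v + w) i = Φ N v i + Φ N w i := by
  have := hΦ.linearity N v w 1 1 i
  rwa [one_smul, one_smul, one_smul, one_smul] at this

/-- By induction on the number of players: the null player axiom settles the games with a null
player, symmetry and reflection those carried by the grand coalition, and these span. -/
theorem ExtendedShapleyAxioms.unique {Φ Ψ : Allocation} (hΦ : ExtendedShapleyAxioms Φ)
    (hΨ : ExtendedShapleyAxioms Ψ) : Φ = Ψ := by
  funext N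
  induction N with
  | zero => exact funext fun v => funext fun i => i.elim0
  | succ N ih =>
    suffices h : ∀ v : CoopGame (N + 1), ∀ k, Φ (N + 1) v k = Ψ (N + 1) v k from
      funext fun v => funext (h v)
    refine mem_of_null_of_univ (K := {v | ∀ k, Φ (N + 1) v k = Ψ (N + 1) v k})
      (fun v hv w hw k => by rw [hΦ.map_add, hΨ.map_add, hv, hw]) (fun v i hi k => ?_)
      (fun v hv k => ?_)
    · have h1 := hΦ.null_player N v i (partialGrad_eq_zero_iff.2 hi)
      have h2 := hΨ.null_player N v i (partialGrad_eq_zero_iff.2 hi)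
      rcases Fin.eq_self_or_eq_succAbove i k with rfl | ⟨j, rfl⟩
      · rw [h1.1, h2.1]
      · refine Subtype.ext (funext fun S => ?_)
        have hS := map_traceCoalition i S
        obtain ⟨a1, b1⟩ := h1.2 j (traceCoalition i S)
        obtain ⟨a2, b2⟩ := h2.2 j (traceCoalition i S)
        by_cases hiS : i ∈ S
        · rw [hS, Finset.insert_erase hiS] at a1 a2
          rw [a1, a2, ← hS, b1, b2, ih]
        · rw [Finset.erase_eq_of_notMem hiS] at hS
          rw [hS] at b1 b2
          rw [b1, b2, ih]
    · refine hΦ.eq_of_swapGame_eq hΨ (fun i j => Subtype.ext (funext fun S => ?_)) k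
      change v.1 (swapCoalition i j S) = v.1 S
      by_cases hS : S = Finset.univ
      · rw [swapCoalition_eq_self (by simp [hS])]
      · rw [hv S hS, hv _ fun h => hS ?_]
        rw [← swapCoalition_swapCoalition i j S, h, swapCoalition_eq_self (by simp)]

end uniqueness

/-! ### The random walk up to the first visit to a coalition -/

section walk

variable {N : ℕ} {Ω : Type*} {X : ℕ → Ω → Coalition N} {S T T' : Coalition N} {n : ℕ} {ω : Ω}

/-- The event that `X` has not visited `S` up to time `n`, that is, `n < τ_S`. -/
def notVisited (X : ℕ → Ω → Coalition N) (S : Coalition N) (n : ℕ) : Set Ω :=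
  {ω | ∀ k ≤ n, X k ω ≠ S}

/-- The amount `G (X_n, X_{n+1})` collected at the step from time `n` to time `n + 1` if this step
is taken before the first visit to `S`, and `0` otherwise. -/
noncomputable def stepTerm (X : ℕ → Ω → Coalition N) (S : Coalition N)
    (G : Coalition N → Coalition N → ℝ) (n : ℕ) : Ω → ℝ :=
  (notVisited X S n).indicator fun ω => G (X n ω) (X (n + 1) ω)

theorem firstVisit_ne_top_iff : firstVisit X S ω ≠ ⊤ ↔ ∃ n, ω ∉ notVisited X S n := by
  simp only [firstVisit, ne_eq, hittingAfter_eq_top_iff, notVisited, Set.mem_ofPred_eq,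
    Set.mem_singleton_iff, not_forall, not_not]
  exact ⟨fun ⟨j, _, h⟩ => ⟨j, j, le_rfl, h⟩, fun ⟨_, k, _, h⟩ => ⟨k, Nat.zero_le k, h⟩⟩

theorem exists_firstVisit_eq (h : firstVisit X S ω ≠ ⊤) :
    ∃ t : ℕ, (firstVisit X S ω).untopD 0 = t ∧ X t ω = S ∧ ∀ n, ω ∈ notVisited X S n ↔ n < t := by
  lift firstVisit X S ω to ℕ using h with t ht
  have hlt : ∀ n : ℕ, t ≤ n ↔ ∃ j ≤ n, X j ω = S := fun n => by
    have := hittingAfter_le_iff (u := X) (s := {S}) (n := 0) (i := n) (ω := ω)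
    rw [← firstVisit, ← ht] at this
    simpa using this
  refine ⟨t, rfl, ?_, fun n => ?_⟩
  · obtain ⟨j, hj, hS⟩ := (hlt t).1 le_rfl
    rwa [le_antisymm hj ((hlt j).2 ⟨j, le_rfl, hS⟩)] at hS
  · rw [← not_le, hlt]
    simp [notVisited]

theorem hasSum_stepTerm (G : Coalition N → Coalition N → ℝ) (h : firstVisit X S ω ≠ ⊤) :
    HasSum (fun n => stepTerm X S G n ω)
      (∑ n ∈ Finset.range ((firstVisit X S ω).untopD 0), G (X n ω) (X (n + 1) ω)) := by
  obtain ⟨t, ht, -, hn⟩ := exists_firstVisit_eq h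
  rw [ht]
  have h1 : ∀ n ∈ Finset.range t, G (X n ω) (X (n + 1) ω) = stepTerm X S G n ω := fun n h => by
    rw [stepTerm, Set.indicator_of_mem ((hn n).2 (Finset.mem_range.1 h))]
  rw [Finset.sum_congr rfl h1]
  refine hasSum_sum_of_ne_finset_zero fun n h => ?_
  rw [stepTerm, Set.indicator_of_notMem fun h' => h (Finset.mem_range.2 ((hn n).1 h'))]

/-- The increments of a function `u` of the walk, collected up to time `min n τ_S`, telescope. -/
theorem exists_sum_stepTerm_eq (u : Coalition N → ℝ) (n : ℕ) (ω : Ω) :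
    ∃ k, ∑ m ∈ Finset.range n, stepTerm X S (fun T T' => u T' - u T) m ω
      = u (X k ω) - u (X 0 ω) := by
  suffices h : ∃ k, (k = n ∨ ω ∉ notVisited X S n) ∧
      ∑ m ∈ Finset.range n, stepTerm X S (fun T T' => u T' - u T) m ω
        = u (X k ω) - u (X 0 ω) from h.imp fun _ => And.right
  induction n with
  | zero => exact ⟨0, by simp⟩
  | succ n ih =>
    obtain ⟨k, hk, hsum⟩ := ih
    rw [Finset.sum_range_succ, hsum, stepTerm]
    by_cases hω : ω ∈ notVisited X S n
    · obtain rfl : k = n := hk.resolve_right fun h => h hω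
      exact ⟨k + 1, Or.inl rfl, by rw [Set.indicator_of_mem hω]; ring⟩
    · refine ⟨k, Or.inr fun h => hω fun m hm => h m (hm.trans n.le_succ), ?_⟩
      rw [Set.indicator_of_notMem hω, add_zero]

theorem stepTerm_eq_sum (G : Coalition N → Coalition N → ℝ) (n : ℕ) :
    stepTerm X S G n = fun ω => ∑ T, ∑ T',
      (notVisited X S n ∩ {ω | X n ω = T} ∩ {ω | X (n + 1) ω = T'}).indicator
        (fun _ => G T T') ω := by
  classical
  ext ω
  simp only [stepTerm, Set.indicator_apply, Set.mem_inter_iff, Set.mem_ofPred_eq, ite_and]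
  by_cases hω : ω ∈ notVisited X S n <;> simp [hω]

theorem pathContribution_eq_sum_range (v : CoopGame N) (i : Fin N) :
    pathContribution X v i S ω = ∑ n ∈ Finset.range ((firstVisit X S ω).untopD 0),
      edgeValue (partialGrad i v.1) (X n ω) (X (n + 1) ω) := by
  rw [pathContribution, Finset.range_eq_Ico,
    show Finset.Icc 1 ((firstVisit X S ω).untopD 0)
      = Finset.Ico (0 + 1) ((firstVisit X S ω).untopD 0 + 1) by ext; simp,
    ← Finset.sum_Ico_add']
  rfl

variable [MeasurableSpace Ω] {P : Measure Ω}

namespace IsCoalitionWalk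

theorem measurableSet_notVisited (hX : IsCoalitionWalk P X) (S : Coalition N) (n : ℕ) :
    MeasurableSet (notVisited X S n) := by
  have : notVisited X S n = ⋂ k, ⋂ _ : k ≤ n, {ω | X k ω = S}ᶜ := by
    ext ω; simp [notVisited]
  rw [this]
  exact .iInter fun k => .iInter fun _ => (hX.measurable k S).compl

variable [IsProbabilityMeasure P]

/-- The Markov property at time `n`, for the event that `S` has not been visited yet. -/
theorem measureReal_notVisited_inter (hX : IsCoalitionWalk P X) (S T T' : Coalition N) (n : ℕ) :
    P.real (notVisited X S n ∩ {ω | X n ω = T} ∩ {ω | X (n + 1) ω = T'})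
      = P.real (notVisited X S n ∩ {ω | X n ω = T}) * walkTransition T T' := by
  let Y : Ω → Fin (n + 1) → Coalition N := fun ω k => X k ω
  let s : Finset (Fin (n + 1) → Coalition N) :=
    Finset.univ.filter fun p => (∀ k, p k ≠ S) ∧ p (Fin.last n) = T
  have hs : Y ⁻¹' s = notVisited X S n ∩ {ω | X n ω = T} := by
    ext ω
    simp [Y, s, notVisited, Fin.forall_iff]
  -- a path up to time `n`, continued by `T'`
  let q : (Fin (n + 1) → Coalition N) → ℕ → Coalition N := fun p k =>
    if h : k < n + 1 then p ⟨k, h⟩ else T'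
  have hq : ∀ p, Y ⁻¹' {p} = {ω | ∀ k ≤ n, X k ω = q p k} := fun p => by
    ext ω
    simp only [Y, Set.mem_preimage, Set.mem_singleton_iff, funext_iff, Fin.forall_iff,
      Set.mem_ofPred_eq, Nat.lt_succ_iff, q]
    exact forall₂_congr fun k hk => by rw [dif_pos hk]
  have hq' : ∀ p, Y ⁻¹' {p} ∩ {ω | X (n + 1) ω = T'} = {ω | ∀ k ≤ n + 1, X k ω = q p k} :=
    fun p => by
      ext ω
      rw [hq]
      simp only [Set.mem_inter_iff, Set.mem_ofPred_eq]
      have : q p (n + 1) = T' := dif_neg (lt_irrefl _)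
      constructor
      · rintro ⟨h1, h2⟩ k hk
        rcases Nat.le_succ_iff.1 hk with hk | rfl
        · exact h1 k hk
        · rw [h2, this]
      · exact fun h => ⟨fun k hk => h k (hk.trans n.le_succ), (h _ le_rfl).trans this⟩
  have hmeas : ∀ p, MeasurableSet (Y ⁻¹' {p}) := fun p => by
    have : Y ⁻¹' {p} = ⋂ k : Fin (n + 1), {ω | X k ω = p k} := by
      ext ω; simp [Y, funext_iff]
    rw [this]
    exact .iInter fun k => hX.measurable k (p k)
  have hs_meas : MeasurableSet (Y ⁻¹' s) := by
    rw [hs]; exact (hX.measurableSet_notVisited S n).inter (hX.measurable n T)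
  rw [← hs, ← measureReal_restrict_apply hs_meas,
    ← sum_measureReal_preimage_singleton s (fun p _ => hmeas p),
    ← sum_measureReal_preimage_singleton s (fun p _ => hmeas p), Finset.sum_mul]
  refine Finset.sum_congr rfl fun p hp => ?_
  rw [measureReal_restrict_apply (hmeas p), hq', hX.markov, hq]
  have h1 : q p n = T := by
    rw [← (Finset.mem_filter.1 hp).2.2]
    exact dif_pos n.lt_succ_self
  rw [h1, show q p (n + 1) = T' from dif_neg (lt_irrefl _)]

theorem integrable_indicator (hX : IsCoalitionWalk P X) (S T T' : Coalition N) (n : ℕ) (c : ℝ) :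
    Integrable ((notVisited X S n ∩ {ω | X n ω = T} ∩ {ω | X (n + 1) ω = T'}).indicator
      fun _ => c) P :=
  (integrable_const c).indicator
    (((hX.measurableSet_notVisited S n).inter (hX.measurable n T)).inter (hX.measurable (n + 1) T'))

theorem integrable_stepTerm (hX : IsCoalitionWalk P X) (G : Coalition N → Coalition N → ℝ)
    (n : ℕ) : Integrable (stepTerm X S G n) P := by
  rw [stepTerm_eq_sum]
  exact integrable_finsetSum _ fun T _ => integrable_finsetSum _ fun T' _ =>
    hX.integrable_indicator S T T' n (G T T')

theorem integral_stepTerm (hX : IsCoalitionWalk P X) (G : Coalition N → Coalition N → ℝ)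
    (n : ℕ) : ∫ ω, stepTerm X S G n ω ∂P
      = ∑ T, P.real (notVisited X S n ∩ {ω | X n ω = T}) * (1 / N * ∑ k, G T (toggle k T)) := by
  rw [stepTerm_eq_sum, integral_finsetSum _ fun T _ => integrable_finsetSum _ fun T' _ =>
    hX.integrable_indicator S T T' n (G T T')]
  refine Finset.sum_congr rfl fun T _ => ?_
  rw [integral_finsetSum _ fun T' _ => hX.integrable_indicator S T T' n (G T T'),
    ← sum_neighbours T (G T), Finset.mul_sum, Finset.mul_sum, Finset.sum_filter]
  refine Finset.sum_congr rfl fun T' _ => ?_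
  rw [integral_indicator_const _ (((hX.measurableSet_notVisited S n).inter
    (hX.measurable n T)).inter (hX.measurable (n + 1) T')), hX.measureReal_notVisited_inter,
    walkTransition, smul_eq_mul]
  split_ifs <;> ring

/-- The expected amount collected at a step depends only on the means of the amounts over the
directions in which a coalition other than `S` can be left. -/
theorem integral_stepTerm_congr (hX : IsCoalitionWalk P X) {G G' : Coalition N → Coalition N → ℝ}
    (h : ∀ T ≠ S, ∑ k, G T (toggle k T) = ∑ k, G' T (toggle k T)) (n : ℕ) :
    ∫ ω, stepTerm X S G n ω ∂P = ∫ ω, stepTerm X S G' n ω ∂P := by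
  rw [hX.integral_stepTerm, hX.integral_stepTerm]
  refine Finset.sum_congr rfl fun T _ => ?_
  by_cases hT : T = S
  · have : notVisited X S n ∩ {ω | X n ω = T} = ∅ := by
      ext ω
      simp only [notVisited, Set.mem_inter_iff, Set.mem_ofPred_eq, Set.mem_empty_iff_false,
        iff_false, not_and]
      exact fun h' => hT ▸ h' n le_rfl
    rw [this, measureReal_empty, zero_mul, zero_mul]
  · rw [h T hT]

/-- The expected first visit time `∑ n, P (n < τ_S)` is finite. Let `u` solve the Poisson equation
whose right-hand side is constant off `S`, so that the mean increment of `u` over a step from a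
coalition other than `S` is `1`. Then `P (m < τ_S)` is the expected increment of `u` over the
`m`-th step before `τ_S`, and the increments up to time `n` telescope to at most
`2 * ∑ T, |u T|`. -/
theorem tsum_measure_notVisited_ne_top (hX : IsCoalitionWalk P X) (S : Coalition N) :
    ∑' n, P (notVisited X S n) ≠ ⊤ := by
  obtain ⟨w, hw⟩ := exists_laplacian_eq
    (fun T : Coalition N => N - (if T = S then (N : ℝ) * 2 ^ N else 0)) (by
      simp [Finset.sum_sub_distrib, mul_comm])
  let u : Coalition N → ℝ := fun T => -w.1 T
  have hu : ∀ T ≠ S, ∑ _k : Fin N, (1 : ℝ) = ∑ k, (u (toggle k T) - u T) := fun T hT => by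
    have := hw T
    rw [if_neg hT, sub_zero] at this
    simp only [Finset.sum_const, Finset.card_univ, Fintype.card_fin, nsmul_eq_mul, mul_one]
    rw [← this]
    exact Finset.sum_congr rfl fun k _ => by simp only [u]; ring
  let B : ℝ := ∑ T, |u T|
  have hB : ∀ T, |u T| ≤ B := fun T =>
    Finset.single_le_sum (f := fun T => |u T|) (fun T _ => abs_nonneg _) (Finset.mem_univ T)
  have hreal : ∀ n, ∑ m ∈ Finset.range n, P.real (notVisited X S m) ≤ 2 * B := fun n => by
    have h1 : ∀ m, P.real (notVisited X S m)
        = ∫ ω, stepTerm X S (fun T T' => u T' - u T) m ω ∂P := fun m => by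
      rw [← hX.integral_stepTerm_congr (G := fun _ _ => 1) hu, stepTerm,
        integral_indicator_const _ (hX.measurableSet_notVisited S m), smul_eq_mul, mul_one]
    simp only [h1]
    rw [← integral_finsetSum _ fun m _ => hX.integrable_stepTerm _ m]
    have h2 := integral_mono (integrable_finsetSum (Finset.range n) fun m _ =>
      hX.integrable_stepTerm (S := S) (fun T T' => u T' - u T) m)
      (integrable_const (μ := P) (2 * B)) (fun ω => by
        obtain ⟨k, hk⟩ := exists_sum_stepTerm_eq (X := X) (S := S) u n ω
        dsimp only
        rw [hk]
        linarith [(abs_le.1 (hB (X k ω))).2, (abs_le.1 (hB (X 0 ω))).1])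
    simpa using h2
  refine ne_top_of_le_ne_top (ENNReal.ofReal_ne_top (r := 2 * B))
    (ENNReal.tsum_le_of_sum_range_le fun n => ?_)
  refine le_trans (le_of_eq ?_) (ENNReal.ofReal_le_ofReal (hreal n))
  rw [ENNReal.ofReal_sum_of_nonneg fun _ _ => measureReal_nonneg]
  exact Finset.sum_congr rfl fun m _ => (ofReal_measureReal).symm

theorem ae_firstVisit_ne_top (hX : IsCoalitionWalk P X) (S : Coalition N) :
    ∀ᵐ ω ∂P, firstVisit X S ω ≠ ⊤ := by
  filter_upwards [ae_finite_setOfPred_mem (hX.tsum_measure_notVisited_ne_top S)] with ω hω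
  rw [firstVisit_ne_top_iff]
  by_contra! h
  simp [h, Set.infinite_univ] at hω

theorem tsum_lintegral_stepTerm_ne_top (hX : IsCoalitionWalk P X) (S : Coalition N)
    (G : Coalition N → Coalition N → ℝ) :
    ∑' n, ∫⁻ ω, ‖stepTerm X S G n ω‖ₑ ∂P ≠ ⊤ := by
  have hle : ∀ n, ∫⁻ ω, ‖stepTerm X S G n ω‖ₑ ∂P
      ≤ (∑ T, ∑ T', ‖G T T'‖ₑ) * P (notVisited X S n) := fun n => by
    rw [← lintegral_indicator_const (hX.measurableSet_notVisited S n)]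
    refine lintegral_mono fun ω => ?_
    rw [stepTerm, enorm_indicator_eq_indicator_enorm]
    refine Set.indicator_le_indicator ?_
    exact (Finset.single_le_sum (f := fun T' => ‖G (X n ω) T'‖ₑ) (fun _ _ => zero_le)
      (Finset.mem_univ (X (n + 1) ω))).trans
      (Finset.single_le_sum (f := fun T => ∑ T', ‖G T T'‖ₑ) (fun _ _ => zero_le)
      (Finset.mem_univ (X n ω)))
  refine ne_top_of_le_ne_top ?_ (ENNReal.tsum_le_tsum hle)
  rw [ENNReal.tsum_mul_left]
  exact ENNReal.mul_ne_top (by simp [ENNReal.sum_eq_top]) (hX.tsum_measure_notVisited_ne_top S)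

theorem integrable_tsum_stepTerm (hX : IsCoalitionWalk P X) (S : Coalition N)
    (G : Coalition N → Coalition N → ℝ) :
    Integrable (fun ω => ∑' n, stepTerm X S G n ω) P := by
  refine ⟨?_, ?_⟩
  · refine aestronglyMeasurable_of_tendsto_ae Filter.atTop
      (f := fun n ω => ∑ m ∈ Finset.range n, stepTerm X S G m ω)
      (fun n => (integrable_finsetSum _ fun m _ => hX.integrable_stepTerm G m).1) ?_
    filter_upwards [hX.ae_firstVisit_ne_top S] with ω hω
    exact (hasSum_stepTerm G hω).summable.hasSum.tendsto_sum_nat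
  · refine lt_of_le_of_lt (lintegral_mono fun ω => enorm_tsum_le_tsum_enorm) ?_
    rw [lintegral_tsum fun n => (hX.integrable_stepTerm G n).1.enorm]
    exact (hX.tsum_lintegral_stepTerm_ne_top S G).lt_top

theorem ae_pathContribution_eq (hX : IsCoalitionWalk P X) (v : CoopGame N) (i : Fin N)
    (S : Coalition N) :
    pathContribution X v i S
      =ᵐ[P] fun ω => ∑' n, stepTerm X S (edgeValue (partialGrad i v.1)) n ω := by
  filter_upwards [hX.ae_firstVisit_ne_top S] with ω hω
  rw [(hasSum_stepTerm _ hω).tsum_eq, pathContribution_eq_sum_range]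

theorem integrable_pathContribution (hX : IsCoalitionWalk P X) (v : CoopGame N) (i : Fin N)
    (S : Coalition N) : Integrable (pathContribution X v i S) P :=
  (hX.integrable_tsum_stepTerm S _).congr (hX.ae_pathContribution_eq v i S).symm

/-- At every coalition the mean of `d_i v` over the directions equals that of `d v_i`, so the
amounts may be replaced by the increments of `v_i`, which telescope to `v_i S - v_i ∅`. -/
theorem pathValue_eq (hX : IsCoalitionWalk P X) (v : CoopGame N) (i : Fin N) (S : Coalition N) :
    pathValue P X v i S = (componentGame N v i).1 S := by
  set u := (componentGame N v i).1 with hu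
  have hu0 : u ∅ = 0 := (componentGame N v i).2
  have hstep : ∀ n, ∫ ω, stepTerm X S (edgeValue (partialGrad i v.1)) n ω ∂P
      = ∫ ω, stepTerm X S (fun T T' => u T' - u T) n ω ∂P := by
    refine hX.integral_stepTerm_congr fun T _ => ?_
    have := componentGame_eq v i T
    rw [Finset.sum_sub_distrib] at this ⊢
    simp only [edgeValue_partialGrad_toggle, Finset.sum_ite_eq', Finset.mem_univ, if_true]
    linarith
  rw [pathValue, integral_congr_ae (hX.ae_pathContribution_eq v i S),
    integral_tsum (fun n => (hX.integrable_stepTerm _ n).1) (hX.tsum_lintegral_stepTerm_ne_top S _)]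
  simp only [hstep]
  rw [← integral_tsum (fun n => (hX.integrable_stepTerm _ n).1)
    (hX.tsum_lintegral_stepTerm_ne_top S _)]
  have : (fun ω => ∑' n, stepTerm X S (fun T T' => u T' - u T) n ω) =ᵐ[P] fun _ => u S := by
    filter_upwards [hX.ae_firstVisit_ne_top S, hX.start] with ω hω hω0
    obtain ⟨t, ht, hS, -⟩ := exists_firstVisit_eq hω
    rw [(hasSum_stepTerm _ hω).tsum_eq, ht,
      Finset.sum_range_sub (fun n => u (X n ω)), hS, hω0, hu0, sub_zero]
  rw [integral_congr_ae this]
  simp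

end IsCoalitionWalk

end walk

theorem theorem3 :
    ∃ c : Allocation,
      -- `c N v i` is the component game `v_i`, the unique solution of the least squares equation
      (∀ (N : ℕ) (v : CoopGame N) (i : Fin N) (u : CoopGame N),
        IsComponentGame v i u ↔ u = c N v i) ∧
      -- the component games are characterized by the extended Shapley axioms
      (∀ Φ : Allocation, ExtendedShapleyAxioms Φ ↔ Φ = c) ∧
      -- `V_i` is well defined and equal to `v_i`
      (∀ (N : ℕ) (Ω : Type*) [MeasurableSpace Ω] (P : MeasureTheory.Measure Ω)
        [MeasureTheory.IsProbabilityMeasure P] (X : ℕ → Ω → Coalition N),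
        IsCoalitionWalk P X → ∀ (v : CoopGame N) (i : Fin N) (S : Coalition N),
          (∀ᵐ ω ∂P, firstVisit X S ω ≠ ⊤) ∧
          MeasureTheory.Integrable (pathContribution X v i S) P ∧
          pathValue P X v i S = (c N v i).1 S) := by
  refine ⟨componentGame, fun _ _ _ _ => isComponentGame_iff_eq, fun Φ => ⟨fun h =>
    h.unique extendedShapleyAxioms_componentGame, ?_⟩, ?_⟩
  · rintro rfl
    exact extendedShapleyAxioms_componentGame
  · intro N Ω _ P _ X hX v i S
    exact ⟨hX.ae_firstVisit_ne_top S, hX.integrable_pathContribution v i S, hX.pathValue_eq v i S⟩
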